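/- Let $X_1,\dots,X_p$ be independent $\{+1,-1\}$-valued random variables with $\Pr(X_i=1)=p_i$ and $\mu_i=\mathbb{E}[X_i]$, let $$f(x)=\sum_{(i,j)\in Q}\beta_{i,j}x_ix_j+\sum_{j\in L}\alpha_jx_j+c,\qquad Q\subseteq[p]\times[p],\ L\subseteq[p],$$ with $|Q|+|L|\le s$ and $|\beta_{i,j}|,|\alpha_j|,|c|\le b$, and for $\gamma>0$ let $Y\in\{0,1\}$ satisfy $\Pr(Y=1\mid X=x)=\sigma(\gamma f(x))$, where $\sigma(x)=\frac12+\frac12L(x)$ and $L(x)=\max(-1,\min(x,1))$. Let $r$ be the number of variables that $f$ (as a function on $\{+1,-1\}^p$) depends on, let $v_1,\dots,v_m$ be the distinct nonzero values of $f$ on $\{+1,-1\}^p$, with $v_m$ one of smallest modulus, and let $G$ be the graph on the variables with an edge $\{i,j\}$ ($i\ne j$) whenever $(i,j)\in Q$. Let $\epsilon>0$ and $\delta>0$. Assume that $$\Bigl|\sum_{(i,j)\in Q}\beta_{i,j}s_{i,j}+\sum_{j\in L}\alpha_js_j+c\,s_c\Bigr|>\epsilon$$ for all choices of $s_{i,j},s_j,s_c\in\{0,+1,-1\}$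 that are not all zero, and that $p_i\in(\delta,\frac12-\delta)\cup(\frac12+\delta,1-\delta)$ for all $i$. Put $\delta'=\bigl|\log\frac{2}{1-2\delta}\bigr|$ and $\delta''=\delta^{2r}\min(2^{\delta'/2}-1,\,1-2^{-\delta'/2})$. Let $x_k$ be any of the variables (for instance $x_1$). If $f$ does not depend on $x_k$, then $|\mathbb{E}[Y(X_k-\mu_k)]|=0$ for every $\gamma>0$. If $f$ depends on $x_k$, then $(0,\frac1{|v_m|})\subseteq(0,\frac1\epsilon)$ and: 1. if the connected component of $G$ containing $x_k$ contains a variable with a linear term in $f$, then $$|\mathbb{E}[Y(X_k-\mu_k)]|>\frac1{32}\,\frac{\epsilon^2\delta^{r+2}}{b^2s^2}$$ for all $\gamma$ in a measurable subset of $(0,\frac1{|v_m|})$ of Lebesgue measure at least $\frac38\,\frac{m\epsilon}{b^2s^2}$; 2. if that component contains no variable with a linear term in $f$, then $$|\mathbb{E}[Y(X_k-\mu_k)]|>\frac1{32}\,\frac{\epsilon^2\delta^2\delta''}{b^2s^2}$$ for all $\gamma$ in a measurable subset of $(0,\frac1{|v_m|})$ of Lebesgue measure at least $\frac3{32}\,\frac{m\epsilon}{b^2s^2}$.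 -/

import Mathlib

open MeasureTheory ProbabilityTheory

noncomputable section

/-- The data of a quadratic polynomial
`f(x) = ∑_{(i,j) ∈ Q} β_{i,j} x_i x_j + ∑_{j ∈ L} α_j x_j + c` in `n` variables. Only the values of
`β` on `Q` and of `α` on `L` matter. -/
structure QuadPoly (n : ℕ) where
  /-- index set of the quadratic terms -/
  Q : Finset (Fin n × Fin n)
  /-- index set of the linear terms -/
  L : Finset (Fin n)
  /-- quadratic coefficients -/
  β : Fin n × Fin n → ℝ
  /-- linear coefficients -/
  α : Fin n → ℝ
  /-- constant term -/
  c : ℝ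

/-- The Boolean cube `{+1, -1}^n`. -/
abbrev Cube (n : ℕ) : Type := Fin n → ℤˣ

/-- A point of the Boolean cube as a real vector. -/
def Cube.toReal {n : ℕ} (x : Cube n) : Fin n → ℝ := fun i => ((x i : ℤ) : ℝ)

namespace QuadPoly

variable {n : ℕ} (f : QuadPoly n)

/-- The value `f(x)`. -/
def eval (x : Fin n → ℝ) : ℝ :=
  ∑ q ∈ f.Q, f.β q * (x q.1 * x q.2) + ∑ j ∈ f.L, f.α j * x j + f.c

/-- All coefficients, the constant included, are at most `b` in absolute value. -/
def CoeffBound (b : ℝ) : Prop :=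
  (∀ q ∈ f.Q, |f.β q| ≤ b) ∧ (∀ j ∈ f.L, |f.α j| ≤ b) ∧ |f.c| ≤ b

/-- `f` has at most `s` quadratic and linear terms. -/
def Sparse (s : ℕ) : Prop := f.Q.card + f.L.card ≤ s

/-- Quantitative general position: every combination of the coefficients with signs in
`{0, +1, -1}`, not all of them zero, has modulus larger than `ε`. -/
def GeneralPosition (ε : ℝ) : Prop :=
  ∀ (sQ : Fin n × Fin n → SignType) (sL : Fin n → SignType) (sc : SignType),
    ((∃ q ∈ f.Q, sQ q ≠ 0) ∨ (∃ j ∈ f.L, sL j ≠ 0) ∨ sc ≠ 0) →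
      ε < |∑ q ∈ f.Q, f.β q * (sQ q : ℝ) + ∑ j ∈ f.L, f.α j * (sL j : ℝ) + f.c * (sc : ℝ)|

/-- As a function on the Boolean cube, `f` depends on the variable `x_k`. -/
def DependsOnVar (k : Fin n) : Prop :=
  ∃ x y : Cube n, (∀ i, i ≠ k → x i = y i) ∧ f.eval x.toReal ≠ f.eval y.toReal

open Classical in
/-- The number `r` of variables that `f` depends on. -/
def numRelevant : ℕ := (Finset.univ.filter fun k => f.DependsOnVar k).card

/-- The graph with an edge `{i, j}` for each `(i, j) ∈ Q`, `i ≠ j`. -/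
def graph : SimpleGraph (Fin n) := SimpleGraph.fromRel fun i j => (i, j) ∈ f.Q

/-- The connected component of `k` in the graph of `f` contains a variable with a linear term. -/
def ComponentHasLinear (k : Fin n) : Prop := ∃ j ∈ f.L, f.graph.Reachable k j

open Classical in
/-- The finite set `{v_1, …, v_m}` of nonzero values of `f` on the Boolean cube. -/
def nonzeroValues : Finset ℝ :=
  (Finset.univ.image fun x : Cube n => f.eval x.toReal).filter fun v => v ≠ 0

end QuadPoly

/-- The function `L`: the identity on `[-1, 1]`, clipped to `±1` outside. -/
def clip (x : ℝ) : ℝ := max (-1) (min x 1)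

/-- The clipped piecewise-linear nonlinearity `σ = 1/2 + L/2`. -/
def clippedSigma (x : ℝ) : ℝ := 1 / 2 + 1 / 2 * clip x

/-- The observation model with nonlinearity `σ` and scaling `γ`: `X_1, …, X_n` are independent,
`X_i = 1` with probability `p_i` and `X_i = -1` with probability `1 - p_i`, and `Y ∈ {0, 1}` with
`Pr(Y = 1 | X = x) = σ(γ f(x))` for each `x` of positive probability. -/
structure QuadModel {n : ℕ} {Ω : Type*} [MeasurableSpace Ω] (P : Measure Ω) (σ : ℝ → ℝ)
    (f : QuadPoly n) (p : Fin n → ℝ) (γ : ℝ) (X : Fin n → Ω → ℝ) (Y : Ω → ℝ) : Prop where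
  measurable_X : ∀ i, Measurable (X i)
  measurable_Y : Measurable Y
  indep : iIndepFun X P
  prob_one : ∀ i, P.real {ω | X i ω = 1} = p i
  prob_neg_one : ∀ i, P.real {ω | X i ω = -1} = 1 - p i
  binary : ∀ᵐ ω ∂P, Y ω = 0 ∨ Y ω = 1
  cond_prob : ∀ x : Cube n, P {ω | ∀ i, X i ω = x.toReal i} ≠ 0 →
    (P[|{ω | ∀ i, X i ω = x.toReal i}]).real {ω | Y ω = 1} = σ (γ * f.eval x.toReal)

/-- The correlation `E[Y (Z - E[Z])]`. -/
def correlation {Ω : Type*} [MeasurableSpace Ω] (P : Measure Ω) (Y Z : Ω → ℝ) : ℝ :=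
  ∫ ω, Y ω * (Z ω - ∫ ω', Z ω' ∂P) ∂P

/-- `δ' = |log (2 / (1 - 2 δ))|`. -/
def deltaPrime (δ : ℝ) : ℝ := |Real.log (2 / (1 - 2 * δ))|

/-- `δ'' = δ^{2r} min (2^{δ'/2} - 1, 1 - 2^{-δ'/2})`. -/
def deltaDoublePrime (δ : ℝ) (r : ℕ) : ℝ :=
  δ ^ (2 * r) *
    min ((2 : ℝ) ^ (deltaPrime δ / 2) - 1) (1 - (2 : ℝ) ^ (-(deltaPrime δ / 2)))

end

/-! The correlation is half of g(γ) = ∑ a_v clip(γ v), summed over the values v of `f`, where a_v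
(`fibreSum`) sums weight(x) (x_k - μ_k) over the fibre f = v. The constant 1/2 in σ drops out
because the total of these tilted weights is zero. So g is piecewise affine in γ > 0, and its slope
changes by a_v v in modulus at 1/|v|.

General position keeps the moduli |v| at least 2ε apart, and |v||w| ≤ b²s² for distinct values, so
the breakpoints are at least 2h apart with h = ε/(b²s²). On one side of 1/|v| the slope is at least
|a_v v|/2 in modulus, so on an interval of length h there g is small only on a short piece. The
windows of different v are disjoint, hence the measures add up (`exists_large_sum_clip`).

It remains to bound |a_v| from below. By general position, f(x) = f(y) only if every monomial agrees
at x and y, so x_k x_j is constant on a fibre for each j in the component of k. If the component has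
a linear term, x_k itself is constant on the fibre and nothing cancels. Otherwise flipping the whole
component preserves `f`; pairing x with its flip produces the factor 1 - exp(-E(x)), E being the
log-odds of the rest of the component. Since x_k E(x) is constant on the fibre, the paired terms
share one sign. E may be nearly 0 on some fibres, but flipping a neighbour of k moves it by twice a
log-odds, so at least half of the values are good (`card_nonzeroValues_le`). -/

/-- Half the difference of two signs, as an element of `{0, +1, -1}`. -/
def halfDiff (u v : ℤˣ) : SignType := if u = v then 0 else if u = 1 then 1 else -1

theorem coe_halfDiff (u v : ℤˣ) :
    ((halfDiff u v : SignType) : ℝ) = (((u : ℤ) : ℝ) - ((v : ℤ) : ℝ)) / 2 := by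
  rcases Int.units_eq_one_or u with rfl | rfl <;> rcases Int.units_eq_one_or v with rfl | rfl <;>
    (simp [halfDiff]; try norm_num)

theorem halfDiff_ne_zero {u v : ℤˣ} (h : u ≠ v) : halfDiff u v ≠ 0 := by
  unfold halfDiff
  rw [if_neg h]
  split_ifs <;> decide

theorem add_add_add_add_add_comm (a b c a' b' c' : ℝ) :
    a + b + c + (a' + b' + c') = a + a' + (b + b') + (c + c') := by ring

theorem abs_unit_cast (u : ℤˣ) : |((u : ℤ) : ℝ)| = 1 := by
  rcases Int.units_eq_one_or u with rfl | rfl <;> simp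

/-! ### Product weights and sign flips on the cube -/

namespace Cube

variable {n : ℕ}

/-- Change the sign of the coordinates in `C`. -/
def flip (C : Finset (Fin n)) (x : Cube n) : Cube n := fun i => if i ∈ C then -x i else x i

theorem flip_flip (C : Finset (Fin n)) (x : Cube n) : flip C (flip C x) = x := by
  ext i
  by_cases h : i ∈ C <;> simp [flip, h]

theorem flip_apply_mem {C : Finset (Fin n)} {i : Fin n} (h : i ∈ C) (x : Cube n) :
    flip C x i = -x i := if_pos h

theorem flip_apply_notMem {C : Finset (Fin n)} {i : Fin n} (h : i ∉ C) (x : Cube n) :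
    flip C x i = x i := if_neg h

/-- Sign change as a permutation of the cube. -/
def flipEquiv (C : Finset (Fin n)) : Equiv.Perm (Cube n) :=
  ⟨flip C, flip C, flip_flip C, flip_flip C⟩

/-- The probability of the point `x` under the product measure with `P(x_i = 1) = p_i`. -/
noncomputable def weight (p : Fin n → ℝ) (x : Cube n) : ℝ :=
  ∏ i, if x i = 1 then p i else 1 - p i

/-- The weight of `x`, multiplied by the centred coordinate `x_k - (2 p_k - 1)`. -/
noncomputable def tilt (p : Fin n → ℝ) (k : Fin n) (x : Cube n) : ℝ :=
  weight p x * (x.toReal k - (2 * p k - 1))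

/-- The log-odds of the probability `t`. -/
noncomputable def logOdds (t : ℝ) : ℝ := Real.log (t / (1 - t))

theorem exp_logOdds {t : ℝ} (h0 : 0 < t) (h1 : t < 1) : Real.exp (logOdds t) = t / (1 - t) :=
  Real.exp_log (div_pos h0 (by linarith))

theorem weight_pos {p : Fin n → ℝ} (h0 : ∀ i, 0 < p i) (h1 : ∀ i, p i < 1) (x : Cube n) :
    0 < weight p x := by
  refine Finset.prod_pos fun i _ => ?_
  split_ifs
  · exact h0 i
  · linarith [h1 i]

theorem weight_flip {p : Fin n → ℝ} (h0 : ∀ i, 0 < p i) (h1 : ∀ i, p i < 1)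
    (C : Finset (Fin n)) (x : Cube n) :
    weight p (flip C x) = weight p x * Real.exp (-∑ i ∈ C, x.toReal i * logOdds (p i)) := by
  have key : Real.exp (-∑ i ∈ C, x.toReal i * logOdds (p i))
      = ∏ i, if i ∈ C then Real.exp (-(x.toReal i * logOdds (p i))) else 1 := by
    rw [← Finset.sum_neg_distrib, Real.exp_sum, Finset.prod_ite_mem]
    simp
  rw [key, weight, weight, ← Finset.prod_mul_distrib]
  refine Finset.prod_congr rfl fun i _ => ?_
  have a := h0 i
  have c : 0 < 1 - p i := by linarith [h1 i]
  by_cases h : i ∈ C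
  · rw [flip_apply_mem h, if_pos h]
    rcases Int.units_eq_one_or (x i) with hx | hx
    · simp only [hx, toReal, Real.exp_neg, Units.val_one, Int.cast_one, one_mul,
        exp_logOdds a (h1 i)]
      rw [if_neg (by decide), if_pos trivial]
      field_simp
    · simp only [hx, toReal, Units.val_neg, Units.val_one, Int.cast_neg, Int.cast_one,
        neg_mul, one_mul, neg_neg, exp_logOdds a (h1 i)]
      rw [if_pos trivial, if_neg (by decide)]
      field_simp
  · rw [flip_apply_notMem h, if_neg h, mul_one]

/-- The factor at k is 2 p_k (1 - p_k) times the sign x_k, so a flip negates it exactly; only the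
other flipped coordinates contribute log-odds. -/
theorem tilt_flip {p : Fin n → ℝ} (h0 : ∀ i, 0 < p i) (h1 : ∀ i, p i < 1) {k : Fin n}
    {C : Finset (Fin n)} (hk : k ∈ C) (x : Cube n) :
    tilt p k (flip C x)
      = -tilt p k x * Real.exp (-∑ i ∈ C.erase k, x.toReal i * logOdds (p i)) := by
  rw [tilt, weight_flip h0 h1, ← Finset.add_sum_erase C _ hk, neg_add, Real.exp_add, tilt]
  have a := h0 k
  have c : 0 < 1 - p k := by linarith [h1 k]
  have : Real.exp (-(x.toReal k * logOdds (p k))) * ((flip C x).toReal k - (2 * p k - 1))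
      = -(x.toReal k - (2 * p k - 1)) := by
    simp only [toReal, flip_apply_mem hk]
    rcases Int.units_eq_one_or (x k) with hx | hx
    · simp only [hx, Real.exp_neg, Units.val_neg, Units.val_one, Int.cast_neg, Int.cast_one,
        one_mul, exp_logOdds a (h1 k)]
      field_simp
      ring
    · simp only [hx, Units.val_neg, Units.val_one, Int.cast_neg, Int.cast_one,
        neg_mul, one_mul, neg_neg, exp_logOdds a (h1 k)]
      field_simp
      ring
  linear_combination (weight p x *
    Real.exp (-∑ i ∈ C.erase k, x.toReal i * logOdds (p i))) * this

theorem sum_tilt_mul_eq_zero {p : Fin n → ℝ} (h0 : ∀ i, 0 < p i) (h1 : ∀ i, p i < 1) (k : Fin n)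
    (h : Cube n → ℝ) (hh : ∀ x, h (flip {k} x) = h x) : ∑ x, tilt p k x * h x = 0 := by
  have e : ∑ x, tilt p k x * h x = ∑ x, -(tilt p k x * h x) := by
    rw [← Equiv.sum_comp (flipEquiv {k})]
    refine Finset.sum_congr rfl fun x _ => ?_
    change tilt p k (flip {k} x) * h (flip {k} x) = _
    rw [hh, tilt_flip h0 h1 (Finset.mem_singleton_self k)]
    simp
  rw [Finset.sum_neg_distrib] at e
  linarith

/-- The sum factorises over coordinates: each one in `R` gives at least δ, each free one gives 1. -/
theorem pow_card_le_sum_weight {p : Fin n → ℝ} {δ : ℝ} (hδ : 0 < δ) (h0 : ∀ i, δ < p i)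
    (h1 : ∀ i, p i < 1 - δ) (R : Finset (Fin n)) (x₀ : Cube n) :
    δ ^ R.card ≤ ∑ x with ∀ i ∈ R, x i = x₀ i, weight p x := by
  have e : (Finset.univ.filter fun x : Cube n => ∀ i ∈ R, x i = x₀ i)
      = Fintype.piFinset fun i => if i ∈ R then {x₀ i} else Finset.univ := by
    ext x
    simp only [Finset.mem_filter, Finset.mem_univ, true_and, Fintype.mem_piFinset]
    refine forall_congr' fun i => ?_
    by_cases h : i ∈ R
    · simp [h]
    · simp [h, Int.units_eq_one_or]
  rw [e]
  simp only [weight]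
  rw [← Finset.prod_univ_sum (fun i => if i ∈ R then {x₀ i} else Finset.univ)
    (fun i (u : ℤˣ) => if u = 1 then p i else 1 - p i)]
  have : δ ^ R.card = ∏ i, if i ∈ R then δ else 1 := by
    rw [Finset.prod_ite_mem]
    simp
  rw [this]
  refine Finset.prod_le_prod (fun i _ => by split_ifs <;> linarith) fun i _ => ?_
  have a := h0 i
  have c := h1 i
  by_cases h : i ∈ R
  · rw [if_pos h, if_pos h, Finset.sum_singleton]
    split_ifs <;> linarith
  · rw [if_neg h, if_neg h,
      show (Finset.univ : Finset ℤˣ) = {1, -1} from rfl,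
      Finset.sum_pair (by decide), if_pos rfl, if_neg (by decide)]
    linarith

end Cube

/-! ### Consequences of general position and of the coefficient bound -/

namespace QuadPoly

variable {n : ℕ} (f : QuadPoly n)

theorem eval_toReal (x : Cube n) : f.eval x.toReal =
    ∑ q ∈ f.Q, f.β q * (((x q.1 * x q.2 : ℤˣ) : ℤ) : ℝ) + ∑ j ∈ f.L, f.α j * ((x j : ℤ) : ℝ)
      + f.c := by
  simp [eval, Cube.toReal]

/-- All the monomials of `f` have the same values at `x` and `y`. -/
def SameTerms (x y : Cube n) : Prop :=
  (∀ q ∈ f.Q, x q.1 * x q.2 = y q.1 * y q.2) ∧ ∀ j ∈ f.L, x j = y j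

variable {f}

theorem SameTerms.eval_eq {x y : Cube n} (h : f.SameTerms x y) :
    f.eval x.toReal = f.eval y.toReal := by
  rw [eval_toReal, eval_toReal]
  congr 2
  · exact Finset.sum_congr rfl fun q hq => by rw [h.1 q hq]
  · exact Finset.sum_congr rfl fun q hq => by rw [h.2 q hq]

theorem SameTerms.flip {x y : Cube n} (h : f.SameTerms x y) (C : Finset (Fin n)) :
    f.SameTerms (Cube.flip C x) (Cube.flip C y) := by
  refine ⟨fun q hq => ?_, fun j hj => ?_⟩
  · have := h.1 q hq
    unfold Cube.flip
    split_ifs <;> simp [this]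
  · have := h.2 j hj
    unfold Cube.flip
    split_ifs <;> simp [this]

variable {ε : ℝ}

/-- Halving f(x) - f(y) gives a combination with signs in {0, ±1}, in which the constant has sign 0.
-/
theorem GeneralPosition.lt_abs_sub (hgp : f.GeneralPosition ε) {x y : Cube n}
    (h : ¬ f.SameTerms x y) : 2 * ε < |f.eval x.toReal - f.eval y.toReal| := by
  have := hgp (fun q => halfDiff (x q.1 * x q.2) (y q.1 * y q.2)) (fun j => halfDiff (x j) (y j)) 0
    (by
      by_contra hc
      push Not at hc
      refine h ⟨fun q hq => ?_, fun j hj => ?_⟩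
      · by_contra hne
        exact halfDiff_ne_zero hne (hc.1 q hq)
      · by_contra hne
        exact halfDiff_ne_zero hne (hc.2.1 j hj))
  have e : f.eval x.toReal - f.eval y.toReal
      = 2 * (∑ q ∈ f.Q, f.β q * ((halfDiff (x q.1 * x q.2) (y q.1 * y q.2) : SignType) : ℝ)
        + ∑ j ∈ f.L, f.α j * ((halfDiff (x j) (y j) : SignType) : ℝ)
        + f.c * ((0 : SignType) : ℝ)) := by
    simp only [coe_halfDiff, SignType.coe_zero, mul_zero, add_zero]
    rw [eval_toReal, eval_toReal, mul_add, Finset.mul_sum, Finset.mul_sum,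
      add_sub_add_right_eq_sub, add_sub_add_comm, ← Finset.sum_sub_distrib,
      ← Finset.sum_sub_distrib]
    congr 1 <;> exact Finset.sum_congr rfl fun _ _ => by ring
  rw [e, abs_mul, abs_two]
  linarith

/-- Here the constant has sign 1, so the combination is nontrivial for all x and y, equal ones
included. -/
theorem GeneralPosition.lt_abs_add (hgp : f.GeneralPosition ε) (x y : Cube n) :
    2 * ε < |f.eval x.toReal + f.eval y.toReal| := by
  have := hgp (fun q => halfDiff (x q.1 * x q.2) (-(y q.1 * y q.2)))
    (fun j => halfDiff (x j) (-y j)) 1 (Or.inr (Or.inr one_ne_zero))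
  have e : f.eval x.toReal + f.eval y.toReal
      = 2 * (∑ q ∈ f.Q, f.β q * ((halfDiff (x q.1 * x q.2) (-(y q.1 * y q.2)) : SignType) : ℝ)
        + ∑ j ∈ f.L, f.α j * ((halfDiff (x j) (-y j) : SignType) : ℝ)
        + f.c * ((1 : SignType) : ℝ)) := by
    simp only [coe_halfDiff, SignType.coe_one, mul_one]
    rw [eval_toReal, eval_toReal, mul_add, mul_add, Finset.mul_sum, Finset.mul_sum,
      add_add_add_add_add_comm, ← Finset.sum_add_distrib,
      ← Finset.sum_add_distrib, two_mul f.c]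
    congr 2 <;> exact Finset.sum_congr rfl fun _ _ => by push_cast; ring
  rw [e, abs_mul, abs_two]
  linarith

theorem GeneralPosition.lt_abs (hgp : f.GeneralPosition ε) (x : Cube n) :
    ε < |f.eval x.toReal| := by
  have := hgp.lt_abs_add x x
  rw [← two_mul, abs_mul, abs_two] at this
  linarith

theorem GeneralPosition.eval_eq_iff (hgp : f.GeneralPosition ε) (hε : 0 < ε) {x y : Cube n} :
    f.eval x.toReal = f.eval y.toReal ↔ f.SameTerms x y := by
  refine ⟨fun h => ?_, SameTerms.eval_eq⟩
  by_contra hn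
  have := hgp.lt_abs_sub hn
  rw [h, sub_self, abs_zero] at this
  linarith

theorem GeneralPosition.abs_sub_abs (hgp : f.GeneralPosition ε) {x y : Cube n}
    (h : f.eval x.toReal ≠ f.eval y.toReal) :
    2 * ε ≤ |(|f.eval x.toReal| - |f.eval y.toReal|)| := by
  have a := (hgp.lt_abs_sub fun hn => h hn.eval_eq).le
  have c := (hgp.lt_abs_add x y).le
  rcases abs_cases (f.eval x.toReal) with ⟨e, -⟩ | ⟨e, -⟩ <;>
    rcases abs_cases (f.eval y.toReal) with ⟨e', -⟩ | ⟨e', -⟩ <;> rw [e, e']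
  · exact a
  · simpa using c
  · rw [show -f.eval x.toReal - f.eval y.toReal = -(f.eval x.toReal + f.eval y.toReal) by ring,
      abs_neg]
    exact c
  · rw [show -f.eval x.toReal - -f.eval y.toReal = -(f.eval x.toReal - f.eval y.toReal) by ring,
      abs_neg]
    exact a

theorem CoeffBound.nonneg {b : ℝ} (hb : f.CoeffBound b) : 0 ≤ b := (abs_nonneg _).trans hb.2.2

theorem CoeffBound.abs_sub_le {b : ℝ} (hb : f.CoeffBound b) (x y : Cube n) :
    |f.eval x.toReal - f.eval y.toReal| ≤ 2 * b * (f.Q.card + f.L.card) := by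
  have key : ∀ (a : ℝ) (u v : ℤˣ), |a| ≤ b → |a * ((u : ℤ) : ℝ) - a * ((v : ℤ) : ℝ)| ≤ 2 * b := by
    intro a u v h
    refine (abs_sub _ _).trans ?_
    rw [abs_mul, abs_mul, abs_unit_cast, abs_unit_cast]
    linarith
  rw [eval_toReal, eval_toReal, add_sub_add_right_eq_sub, add_sub_add_comm,
    ← Finset.sum_sub_distrib, ← Finset.sum_sub_distrib]
  refine (abs_add_le _ _).trans ?_
  have h1 := (Finset.abs_sum_le_sum_abs _ _).trans (Finset.sum_le_card_nsmul f.Q _ (2 * b)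
    fun q hq => key (f.β q) (x q.1 * x q.2) (y q.1 * y q.2) (hb.1 q hq))
  have h2 := (Finset.abs_sum_le_sum_abs _ _).trans (Finset.sum_le_card_nsmul f.L _ (2 * b)
    fun q hq => key (f.α q) (x q) (y q) (hb.2.1 q hq))
  rw [nsmul_eq_mul] at h1 h2
  linarith

/-- Some monomial takes opposite signs at x and y and cancels in the sum. The 2b it saves pays for
the constant term. -/
theorem CoeffBound.abs_add_le {b : ℝ} (hb : f.CoeffBound b) {x y : Cube n}
    (h : f.eval x.toReal ≠ f.eval y.toReal) :
    |f.eval x.toReal + f.eval y.toReal| ≤ 2 * b * (f.Q.card + f.L.card) := by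
  have b0 := hb.nonneg
  have key : ∀ (a : ℝ) (u v : ℤˣ), |a| ≤ b →
      |a * ((u : ℤ) : ℝ) + a * ((v : ℤ) : ℝ)| ≤ 2 * b := by
    intro a u v h
    refine (_root_.abs_add_le _ _).trans ?_
    rw [abs_mul, abs_mul, abs_unit_cast, abs_unit_cast]
    linarith
  have key0 : ∀ (a : ℝ) (u v : ℤˣ), u ≠ v → |a * ((u : ℤ) : ℝ) + a * ((v : ℤ) : ℝ)| ≤ 0 := by
    intro a u v h
    rcases Int.units_eq_one_or u with rfl | rfl <;>
      rcases Int.units_eq_one_or v with rfl | rfl <;> simp at h ⊢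
  have h1 := (Finset.abs_sum_le_sum_abs _ _).trans (Finset.sum_le_card_nsmul f.Q _ (2 * b)
    fun q hq => key (f.β q) (x q.1 * x q.2) (y q.1 * y q.2) (hb.1 q hq))
  have h2 := (Finset.abs_sum_le_sum_abs _ _).trans (Finset.sum_le_card_nsmul f.L _ (2 * b)
    fun q hq => key (f.α q) (x q) (y q) (hb.2.1 q hq))
  have hc : |f.c + f.c| ≤ 2 * b := by
    rw [← two_mul, abs_mul, abs_two]
    linarith [hb.2.2]
  rw [nsmul_eq_mul] at h1 h2
  rw [eval_toReal, eval_toReal, add_add_add_add_add_comm, ← Finset.sum_add_distrib,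
    ← Finset.sum_add_distrib]
  refine (abs_add_three _ _ _).trans ?_
  have hn : ¬ f.SameTerms x y := fun hn => h hn.eval_eq
  rw [SameTerms, not_and_or] at hn
  push Not at hn
  rcases hn with ⟨q, hq, hne⟩ | ⟨j, hj, hne⟩
  · have h1' := (Finset.abs_sum_le_sum_abs _ _).trans
      (Finset.sum_le_card_nsmul (f.Q.erase q) _ (2 * b)
        fun q hq => key (f.β q) (x q.1 * x q.2) (y q.1 * y q.2) (hb.1 q (Finset.mem_of_mem_erase hq)))
    rw [nsmul_eq_mul, Finset.cast_card_erase_of_mem hq] at h1'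
    have := (_root_.abs_add_le _ _).trans (add_le_add (key0 (f.β q) _ _ hne) h1')
    rw [Finset.add_sum_erase f.Q (fun q => f.β q * (((x q.1 * x q.2 : ℤˣ) : ℤ) : ℝ)
      + f.β q * (((y q.1 * y q.2 : ℤˣ) : ℤ) : ℝ)) hq] at this
    linarith
  · have h2' := (Finset.abs_sum_le_sum_abs _ _).trans
      (Finset.sum_le_card_nsmul (f.L.erase j) _ (2 * b)
        fun q hq => key (f.α q) (x q) (y q) (hb.2.1 q (Finset.mem_of_mem_erase hq)))
    rw [nsmul_eq_mul, Finset.cast_card_erase_of_mem hj] at h2'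
    have := (_root_.abs_add_le _ _).trans (add_le_add (key0 (f.α j) _ _ hne) h2')
    rw [Finset.add_sum_erase f.L (fun q => f.α q * ((x q : ℤ) : ℝ)
      + f.α q * ((y q : ℤ) : ℝ)) hj] at this
    linarith

/-- |f(x)| + |f(y)| is the larger of |f(x) + f(y)| and |f(x) - f(y)|, hence at most 2bs; then AM-GM
applies. -/
theorem CoeffBound.abs_mul_abs_le {b : ℝ} (hb : f.CoeffBound b) {s : ℕ} (hs : f.Sparse s)
    {x y : Cube n} (h : f.eval x.toReal ≠ f.eval y.toReal) :
    |f.eval x.toReal| * |f.eval y.toReal| ≤ b ^ 2 * (s : ℝ) ^ 2 := by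
  have b0 := hb.nonneg
  have hs' : (f.Q.card : ℝ) + f.L.card ≤ s := by exact_mod_cast hs
  have hm : 2 * b * (f.Q.card + f.L.card) ≤ 2 * b * (s : ℝ) := by gcongr
  have h1 := abs_le.1 ((hb.abs_sub_le x y).trans hm)
  have h2 := abs_le.1 ((hb.abs_add_le h).trans hm)
  have h3 : |f.eval x.toReal| + |f.eval y.toReal| ≤ 2 * b * s := by
    rcases abs_cases (f.eval x.toReal) with ⟨e, -⟩ | ⟨e, -⟩ <;>
      rcases abs_cases (f.eval y.toReal) with ⟨e', -⟩ | ⟨e', -⟩ <;> rw [e, e'] <;> linarith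
  nlinarith [sq_nonneg (|f.eval x.toReal| - |f.eval y.toReal|), abs_nonneg (f.eval x.toReal),
    abs_nonneg (f.eval y.toReal)]

theorem eval_eq_of_forall_dependsOnVar {x y : Cube n}
    (h : ∀ i, f.DependsOnVar i → x i = y i) : f.eval x.toReal = f.eval y.toReal := by
  classical
  -- The coordinates of x are replaced by those of y one at a time.
  have key : ∀ S : Finset (Fin n),
      f.eval (Cube.toReal (S.piecewise y x : Cube n)) = f.eval x.toReal := by
    intro S
    induction S using Finset.induction_on with
    | empty => simp
    | insert a S ha ih =>
      rw [← ih]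
      by_cases hd : f.DependsOnVar a
      · congr 2
        ext i
        by_cases hi : i = a
        · subst hi
          simp [ha, h i hd]
        · by_cases hS : i ∈ S <;> simp [hi, hS]
      · by_contra hne
        refine hd ⟨_, _, fun i hi => ?_, hne⟩
        by_cases hS : i ∈ S <;> simp [hi, hS]
  have := key Finset.univ
  rw [Finset.piecewise_univ] at this
  exact this.symm

theorem eval_flip_of_not_dependsOnVar {k : Fin n} (hk : ¬ f.DependsOnVar k) (x : Cube n) :
    f.eval (Cube.flip {k} x).toReal = f.eval x.toReal := by
  refine eval_eq_of_forall_dependsOnVar fun i hi => Cube.flip_apply_notMem ?_ _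
  rw [Finset.mem_singleton]
  rintro rfl
  exact hk hi

theorem pow_numRelevant_le_sum_weight {p : Fin n → ℝ} {δ : ℝ} (hδ : 0 < δ) (h0 : ∀ i, δ < p i)
    (h1 : ∀ i, p i < 1 - δ) (x₀ : Cube n) :
    δ ^ f.numRelevant ≤ ∑ x with f.eval x.toReal = f.eval x₀.toReal, Cube.weight p x := by
  classical
  refine (Cube.pow_card_le_sum_weight hδ h0 h1 _ x₀).trans ?_
  refine Finset.sum_le_sum_of_subset_of_nonneg (fun x hx => ?_) fun x _ _ => ?_
  · simp only [Finset.mem_filter, Finset.mem_univ, true_and] at hx ⊢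
    exact eval_eq_of_forall_dependsOnVar hx
  · exact (Cube.weight_pos (fun i => hδ.trans (h0 i)) (fun i => by linarith [h1 i]) x).le

/-! ### Monomials along the graph -/

theorem graph_adj_iff {i j : Fin n} :
    f.graph.Adj i j ↔ i ≠ j ∧ ((i, j) ∈ f.Q ∨ (j, i) ∈ f.Q) := SimpleGraph.fromRel_adj _ _ _

theorem SameTerms.mul_eq_mul_of_adj {x y : Cube n} (h : f.SameTerms x y) {i j : Fin n}
    (hij : f.graph.Adj i j) : x i * x j = y i * y j := by
  rcases (graph_adj_iff.1 hij).2 with hq | hq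
  · exact h.1 _ hq
  · rw [mul_comm (x i), mul_comm (y i)]
    exact h.1 _ hq

theorem SameTerms.mul_eq_mul_of_reachable {x y : Cube n} (h : f.SameTerms x y) {i j : Fin n}
    (hij : f.graph.Reachable i j) : x i * x j = y i * y j := by
  obtain ⟨w⟩ := hij
  induction w with
  | nil => rw [Int.units_mul_self, Int.units_mul_self]
  | @cons a b c hab _ ih =>
    have e : ∀ z : Cube n, z a * z c = z a * z b * (z b * z c) := fun z => by
      rw [mul_assoc, ← mul_assoc (z b), Int.units_mul_self, one_mul]
    rw [e x, e y, ih, h.mul_eq_mul_of_adj hab]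

end QuadPoly

/-! ### Piecewise affine sums of clipped functions -/

theorem clip_mul_of_mul_abs_le_one {γ w : ℝ} (hγ : 0 < γ) (h : γ * |w| ≤ 1) :
    clip (γ * w) = γ * w := by
  have := abs_le.1 (show |γ * w| ≤ 1 by rwa [abs_mul, abs_of_pos hγ])
  rw [clip, min_eq_left this.2, max_eq_right this.1]

theorem clip_mul_of_one_le_mul_abs {γ w : ℝ} (h : 1 ≤ γ * |w|) :
    clip (γ * w) = w / |w| := by
  have hw : w ≠ 0 := by
    rintro rfl
    rw [abs_zero, mul_zero] at h
    linarith
  rcases lt_or_gt_of_ne hw with h0 | h0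
  · rw [abs_of_neg h0] at h ⊢
    rw [clip, min_eq_left (by linarith), max_eq_left (by linarith), div_neg, div_self hw]
  · rw [abs_of_pos h0] at h ⊢
    rw [clip, min_eq_right (by linarith), max_eq_right (by linarith), div_self hw]

/-- The breakpoint 1/|w| lies outside the window around c, so one affine formula is valid on the
whole window. -/
theorem clip_mul_eq_of_mem_Ioo {c h w γ : ℝ} (hw : w ≠ 0) (hc : h ≤ c)
    (hsep : 2 * h ≤ |1 / |w| - c|) (hγ : γ ∈ Set.Ioo (c - h) (c + h)) :
    clip (γ * w) = γ * (if 1 / |w| ≤ c then 0 else w) + (if 1 / |w| ≤ c then w / |w| else 0) := by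
  have hw' := abs_pos.2 hw
  obtain ⟨g1, g2⟩ := hγ
  have g0 : 0 < γ := by linarith
  split_ifs with hle
  · rw [abs_of_nonpos (by linarith)] at hsep
    rw [clip_mul_of_one_le_mul_abs, mul_zero, zero_add]
    exact (div_le_iff₀ hw').1 (by linarith)
  · rw [abs_of_pos (by linarith)] at hsep
    rw [clip_mul_of_mul_abs_le_one g0, add_zero]
    exact (le_div_iff₀ hw').1 (by linarith)

theorem volume_Ioo_inter_lt_abs_affine (l h K d t : ℝ) (hK : K ≠ 0) (ht : 0 ≤ t) :
    ENNReal.ofReal (h - 2 * (t / |K|))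
      ≤ volume (Set.Ioo l (l + h) ∩ {γ : ℝ | t < |γ * K + d|}) := by
  -- The exceptional γ lie within t/|K| of the zero -d/K.
  have hsub : Set.Ioo l (l + h) ⊆ (Set.Ioo l (l + h) ∩ {γ : ℝ | t < |γ * K + d|})
      ∪ Metric.closedBall (-(d / K)) (t / |K|) := by
    intro γ hγ
    by_cases hlt : t < |γ * K + d|
    · exact Or.inl ⟨hγ, hlt⟩
    · right
      rw [Metric.mem_closedBall, Real.dist_eq, le_div_iff₀ (abs_pos.2 hK), ← abs_mul]
      rw [show (γ - -(d / K)) * K = γ * K + d by field_simp; ring]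
      exact not_lt.1 hlt
  have := (measure_mono hsub).trans (measure_union_le (μ := volume) _ _)
  rw [Real.volume_Ioo, Real.volume_closedBall, add_sub_cancel_left] at this
  rw [ENNReal.ofReal_sub _ (mul_nonneg zero_le_two (div_nonneg ht (abs_nonneg _)))]
  exact tsub_le_iff_right.2 this

theorem exists_large_of_affine_on_Ioo {g : ℝ → ℝ} {l h K d t κ : ℝ} (hκ : 0 < κ) (ht : 0 ≤ t)
    (hK : κ ≤ 2 * |K|) (hg : ∀ γ ∈ Set.Ioo l (l + h), g γ = γ * K + d) :
    ∃ A : Set ℝ, MeasurableSet A ∧ A ⊆ Set.Ioo l (l + h) ∧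
      ENNReal.ofReal (h - 4 * (t / κ)) ≤ volume A ∧ ∀ γ ∈ A, t < |g γ| := by
  have hK0 : 0 < |K| := by linarith
  refine ⟨Set.Ioo l (l + h) ∩ {γ : ℝ | t < |γ * K + d|}, ?_, Set.inter_subset_left, ?_, ?_⟩
  · exact measurableSet_Ioo.inter (measurableSet_lt measurable_const (by fun_prop))
  · refine le_trans (ENNReal.ofReal_le_ofReal ?_)
      (volume_Ioo_inter_lt_abs_affine l h K d t (abs_pos.1 hK0) ht)
    have : t / |K| ≤ t / (κ / 2) := div_le_div_of_nonneg_left ht (by linarith) (by linarith)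
    rw [div_div_eq_mul_div, mul_comm t 2, mul_div_assoc] at this
    linarith
  · rintro γ ⟨hγ, hlt⟩
    rw [hg γ hγ]
    exact hlt

theorem exists_large_sum_clip_near {V : Finset ℝ} {a : ℝ → ℝ} {v vm h t κ : ℝ}
    (hV : ∀ w ∈ V, w ≠ 0) (hmin : ∀ w ∈ V, |vm| ≤ |w|) (hv : v ∈ V) (hvm : vm ∈ V)
    (hh : 0 ≤ h) (hc : h ≤ 1 / |v|) (ht : 0 ≤ t) (hκ : 0 < κ)
    (hsep : ∀ w ∈ V, ∀ w' ∈ V, w ≠ w' → 2 * h ≤ |(1 / |w| - 1 / |w'|)|) (ha : κ ≤ |a v * v|) :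
    ∃ A : Set ℝ, MeasurableSet A ∧ A ⊆ Set.Ioo (1 / |v| - h) (1 / |v| + h) ∧
      A ⊆ Set.Ioo 0 (1 / |vm|) ∧ ENNReal.ofReal (h - 4 * (t / κ)) ≤ volume A ∧
      ∀ γ ∈ A, t < |∑ w ∈ V, a w * clip (γ * w)| := by
  have hv0 := abs_pos.2 (hV v hv)
  have hvm0 := abs_pos.2 (hV vm hvm)
  set c := 1 / |v| with hcdef
  have hcm : c ≤ 1 / |vm| := one_div_le_one_div_of_le hvm0 (hmin v hv)
  -- `M` and `N` are the slope and intercept due to the other values, the same on both sides of c.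
  set M := ∑ w ∈ V.erase v, a w * (if 1 / |w| ≤ c then 0 else w) with hM
  set N := ∑ w ∈ V.erase v, a w * (if 1 / |w| ≤ c then w / |w| else 0) with hN
  have hsum : ∀ γ ∈ Set.Ioo (c - h) (c + h),
      ∑ w ∈ V, a w * clip (γ * w) = a v * clip (γ * v) + (γ * M + N) := by
    intro γ hγ
    rw [← Finset.add_sum_erase V _ hv, hM, hN, Finset.mul_sum, ← Finset.sum_add_distrib]
    congr 1
    refine Finset.sum_congr rfl fun w hw => ?_
    obtain ⟨hne, hwV⟩ := Finset.mem_erase.1 hw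
    rw [clip_mul_eq_of_mem_Ioo (hV w hwV) hc (hsep w hwV v hv hne) hγ]
    ring
  have left : ∀ γ ∈ Set.Ioo (c - h) (c - h + h),
      ∑ w ∈ V, a w * clip (γ * w) = γ * (M + a v * v) + N := by
    intro γ hγ
    rw [sub_add_cancel] at hγ
    rw [hsum γ ⟨hγ.1, by linarith [hγ.2]⟩, clip_mul_of_mul_abs_le_one (by linarith [hγ.1])
      ((le_div_iff₀ hv0).1 hγ.2.le)]
    ring
  have right : ∀ γ ∈ Set.Ioo c (c + h),
      ∑ w ∈ V, a w * clip (γ * w) = γ * M + (N + a v * (v / |v|)) := by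
    intro γ hγ
    have hc0 : 0 < c := one_div_pos.2 hv0
    rw [hsum γ ⟨by linarith [hγ.1], hγ.2⟩, clip_mul_of_one_le_mul_abs
      ((div_le_iff₀ hv0).1 hγ.1.le)]
    ring
  by_cases hslope : κ ≤ 2 * |M + a v * v|
  · obtain ⟨A, hA, hsub, hvol, hlt⟩ := exists_large_of_affine_on_Ioo hκ ht hslope left
    rw [sub_add_cancel] at hsub
    exact ⟨A, hA, hsub.trans (Set.Ioo_subset_Ioo_right (by linarith)),
      hsub.trans (Set.Ioo_subset_Ioo (by linarith) hcm), hvol, hlt⟩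
  -- The two slopes differ by a_v v, so if the left one is small the right one is not.
  · have hslope' : κ ≤ 2 * |M| := by
      have := abs_sub (M + a v * v) M
      rw [add_sub_cancel_left] at this
      linarith [not_le.1 hslope]
    -- Right of 1/|vm| every term is saturated and `M` = 0, so for v = vm the left slope would be
    -- the full a_v v. Hence the right-hand interval is needed only where it stays below 1/|vm|.
    have hne : v ≠ vm := by
      rintro rfl
      refine hslope ?_
      have : M = 0 := by
        rw [hM]
        refine Finset.sum_eq_zero fun w hw => ?_
        rw [if_pos (one_div_le_one_div_of_le hvm0 (hmin w (Finset.mem_of_mem_erase hw))), mul_zero]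
      rw [this, zero_add]
      linarith [abs_nonneg (a v * v)]
    have hs := hsep v hv vm hvm hne
    rw [abs_of_nonpos (by linarith)] at hs
    obtain ⟨A, hA, hsub, hvol, hlt⟩ := exists_large_of_affine_on_Ioo hκ ht hslope' right
    exact ⟨A, hA, hsub.trans (Set.Ioo_subset_Ioo_left (by linarith)),
      hsub.trans (Set.Ioo_subset_Ioo (by linarith) (by linarith)), hvol, hlt⟩

theorem exists_large_sum_clip {V S : Finset ℝ} {a : ℝ → ℝ} {vm h t κ : ℝ}
    (hV : ∀ w ∈ V, w ≠ 0) (hmin : ∀ w ∈ V, |vm| ≤ |w|) (hvm : vm ∈ V)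
    (hh : 0 ≤ h) (hc : ∀ w ∈ V, h ≤ 1 / |w|) (ht : 0 ≤ t) (hκ : 0 < κ)
    (hsep : ∀ w ∈ V, ∀ w' ∈ V, w ≠ w' → 2 * h ≤ |(1 / |w| - 1 / |w'|)|)
    (hS : S ⊆ V) (ha : ∀ v ∈ S, κ ≤ |a v * v|) :
    ∃ A : Set ℝ, MeasurableSet A ∧ A ⊆ Set.Ioo 0 (1 / |vm|) ∧
      ENNReal.ofReal (S.card * (h - 4 * (t / κ))) ≤ volume A ∧
      ∀ γ ∈ A, t < |∑ w ∈ V, a w * clip (γ * w)| := by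
  choose! A hA hwin hsub hvol hlt using fun v (hv : v ∈ S) =>
    exists_large_sum_clip_near hV hmin (hS hv) hvm hh (hc v (hS hv)) ht hκ hsep (ha v hv)
  -- The windows have radius h and centres at least 2h apart.
  have hd : (S : Set ℝ).PairwiseDisjoint A := by
    intro v hv w hw hne
    rw [Function.onFun, Set.disjoint_left]
    intro γ h1 h2
    have e1 := hwin v hv h1
    have e2 := hwin w hw h2
    have := hsep v (hS hv) w (hS hw) hne
    refine absurd this (not_le.2 (abs_lt.2 ⟨?_, ?_⟩)) <;>
      linarith [e1.1, e1.2, e2.1, e2.2]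
  refine ⟨⋃ v ∈ S, A v, S.measurableSet_biUnion hA, Set.iUnion₂_subset hsub, ?_, ?_⟩
  · rw [measure_biUnion_finset hd hA, ENNReal.ofReal_mul (Nat.cast_nonneg _),
      ENNReal.ofReal_natCast, ← nsmul_eq_mul]
    exact Finset.card_nsmul_le_sum _ _ _ hvol
  · intro γ hγ
    obtain ⟨v, hv, hγv⟩ := Set.mem_iUnion₂.1 hγ
    exact hlt v hv γ hγv

/-! ### The correlation as a finite sum over the cube -/

namespace QuadModel

variable {n : ℕ} {Ω : Type*} [MeasurableSpace Ω] {P : Measure Ω} {σ : ℝ → ℝ}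
  {f : QuadPoly n} {p : Fin n → ℝ} {γ : ℝ} {X : Fin n → Ω → ℝ} {Y : Ω → ℝ}

theorem measurableSet_eq (h : QuadModel P σ f p γ X Y) (x : Cube n) :
    MeasurableSet {ω | ∀ i, X i ω = x.toReal i} := by
  rw [Set.ofPred_forall]
  exact MeasurableSet.iInter fun i => h.measurable_X i (measurableSet_singleton _)

theorem measureReal_eq (h : QuadModel P σ f p γ X Y) (x : Cube n) :
    P.real {ω | ∀ i, X i ω = x.toReal i} = Cube.weight p x := by
  have := h.indep.meas_iInter (s := fun i => X i ⁻¹' {x.toReal i})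
    fun i => ⟨_, measurableSet_singleton _, rfl⟩
  have e : {ω | ∀ i, X i ω = x.toReal i} = ⋂ i, X i ⁻¹' {x.toReal i} := by
    ext ω
    simp
  rw [measureReal_def, e, this, ENNReal.toReal_prod, Cube.weight]
  refine Finset.prod_congr rfl fun i _ => ?_
  rcases Int.units_eq_one_or (x i) with hx | hx
  · rw [if_pos hx, ← h.prob_one i, measureReal_def]
    congr 2
    ext ω
    simp [Cube.toReal, hx]
  · rw [if_neg (by rw [hx]; decide), ← h.prob_neg_one i, measureReal_def]
    congr 2
    ext ω
    simp [Cube.toReal, hx]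

theorem measureReal_inter (h : QuadModel P σ f p γ X Y) [IsProbabilityMeasure P]
    (h0 : ∀ i, 0 < p i) (h1 : ∀ i, p i < 1) (x : Cube n) :
    P.real ({ω | ∀ i, X i ω = x.toReal i} ∩ {ω | Y ω = 1})
      = Cube.weight p x * σ (γ * f.eval x.toReal) := by
  have hw := Cube.weight_pos h0 h1 x
  have hne : P {ω | ∀ i, X i ω = x.toReal i} ≠ 0 := by
    intro hz
    rw [← h.measureReal_eq x, measureReal_def, hz] at hw
    simp at hw
  rw [← h.cond_prob x hne, measureReal_def (μ := P[|_]), cond_apply (h.measurableSet_eq x),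
    ENNReal.toReal_mul, ENNReal.toReal_inv, ← measureReal_def, ← measureReal_def,
    h.measureReal_eq x, mul_inv_cancel_left₀ hw.ne']

theorem ae_eq_one_or (h : QuadModel P σ f p γ X Y) [IsProbabilityMeasure P] :
    ∀ᵐ ω ∂P, ∀ i, X i ω = 1 ∨ X i ω = -1 := by
  rw [ae_all_iff]
  intro i
  have m1 : MeasurableSet {ω | X i ω = 1} := h.measurable_X i (measurableSet_singleton _)
  have m2 : MeasurableSet {ω | X i ω = -1} := h.measurable_X i (measurableSet_singleton _)
  have hd : Disjoint {ω | X i ω = 1} {ω | X i ω = -1} := by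
    rw [Set.disjoint_left]
    intro ω (a : X i ω = 1) (c : X i ω = -1)
    rw [a] at c
    norm_num at c
  have hu : P.real ({ω | X i ω = 1} ∪ {ω | X i ω = -1}) = 1 := by
    rw [measureReal_union hd m2, h.prob_one, h.prob_neg_one]
    ring
  have : P ({ω | X i ω = 1} ∪ {ω | X i ω = -1}) = 1 := by
    rw [← ENNReal.toReal_eq_one_iff]
    exact hu
  exact (mem_ae_iff_prob_eq_one (m1.union m2)).2 this

theorem integral_X (h : QuadModel P σ f p γ X Y) [IsProbabilityMeasure P] (i : Fin n) :
    ∫ ω, X i ω ∂P = 2 * p i - 1 := by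
  have m1 : MeasurableSet {ω | X i ω = 1} := h.measurable_X i (measurableSet_singleton _)
  have m2 : MeasurableSet {ω | X i ω = -1} := h.measurable_X i (measurableSet_singleton _)
  have e : (fun ω => X i ω) =ᵐ[P] fun ω =>
      Set.indicator {ω | X i ω = 1} (fun _ => (1 : ℝ)) ω
        - Set.indicator {ω | X i ω = -1} (fun _ => (1 : ℝ)) ω := by
    filter_upwards [h.ae_eq_one_or] with ω hω
    rcases hω i with hx | hx <;> simp [Set.indicator, hx] <;> norm_num
  rw [integral_congr_ae e, integral_sub ((integrable_const _).indicator m1)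
    ((integrable_const _).indicator m2), integral_indicator_const _ m1,
    integral_indicator_const _ m2, h.prob_one, h.prob_neg_one]
  simp
  ring

theorem correlation_eq (h : QuadModel P σ f p γ X Y) [IsProbabilityMeasure P]
    (h0 : ∀ i, 0 < p i) (h1 : ∀ i, p i < 1) (k : Fin n) :
    correlation P Y (X k) = ∑ x, Cube.tilt p k x * σ (γ * f.eval x.toReal) := by
  have mY : MeasurableSet {ω | Y ω = 1} := h.measurable_Y (measurableSet_singleton _)
  have e : (fun ω => Y ω * (X k ω - ∫ ω', X k ω' ∂P)) =ᵐ[P] fun ω =>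
      ∑ x : Cube n, Set.indicator ({ω | ∀ i, X i ω = x.toReal i} ∩ {ω | Y ω = 1})
        (fun _ => x.toReal k - (2 * p k - 1)) ω := by
    filter_upwards [h.ae_eq_one_or, h.binary] with ω hω hy
    rw [h.integral_X]
    let x₀ : Cube n := fun i => if X i ω = 1 then 1 else -1
    have hx₀ : ∀ i, X i ω = x₀.toReal i := fun i => by
      rcases hω i with hx | hx <;> (simp [x₀, Cube.toReal, hx]; try norm_num)
    rw [Finset.sum_eq_single x₀]
    · rcases hy with hy | hy
      · simp [Set.indicator, hy]
      · simp [Set.indicator, hy, hx₀]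
    · intro x _ hne
      refine Set.indicator_of_notMem (fun hm => hne ?_) _
      funext i
      have a : x₀.toReal i = x.toReal i := (hx₀ i).symm.trans (hm.1 i)
      simp only [Cube.toReal] at a
      exact (Units.ext (by exact_mod_cast a)).symm
    · simp
  rw [correlation, integral_congr_ae e, integral_finsetSum _ fun x _ =>
    (integrable_const _).indicator ((h.measurableSet_eq x).inter mY)]
  refine Finset.sum_congr rfl fun x _ => ?_
  rw [integral_indicator_const _ ((h.measurableSet_eq x).inter mY), h.measureReal_inter h0 h1,
    Cube.tilt, smul_eq_mul]
  ring

end QuadModel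

/-! ### Fibre sums and their lower bounds -/

namespace QuadPoly

variable {n : ℕ} {f : QuadPoly n} {ε δ : ℝ} {p : Fin n → ℝ} {k : Fin n}

theorem mem_nonzeroValues {v : ℝ} :
    v ∈ f.nonzeroValues ↔ (∃ x : Cube n, f.eval x.toReal = v) ∧ v ≠ 0 := by
  simp [nonzeroValues]

theorem GeneralPosition.eval_mem_nonzeroValues (hgp : f.GeneralPosition ε) (hε : 0 < ε)
    (x : Cube n) : f.eval x.toReal ∈ f.nonzeroValues :=
  mem_nonzeroValues.2 ⟨⟨x, rfl⟩, abs_pos.1 (hε.trans (hgp.lt_abs x))⟩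

open Classical in
/-- The sum of the tilted weights over the points at which `f` has the value `v`. -/
noncomputable def fibreSum (f : QuadPoly n) (p : Fin n → ℝ) (k : Fin n) (v : ℝ) : ℝ :=
  ∑ x with f.eval x.toReal = v, Cube.tilt p k x

theorem GeneralPosition.sum_tilt_mul_clippedSigma (hgp : f.GeneralPosition ε) (hε : 0 < ε)
    (h0 : ∀ i, 0 < p i) (h1 : ∀ i, p i < 1) (γ : ℝ) :
    ∑ x, Cube.tilt p k x * clippedSigma (γ * f.eval x.toReal)
      = 1 / 2 * ∑ v ∈ f.nonzeroValues, f.fibreSum p k v * clip (γ * v) := by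
  have hz := Cube.sum_tilt_mul_eq_zero h0 h1 k (fun _ => 1) fun _ => rfl
  have e : ∑ x, Cube.tilt p k x * clip (γ * f.eval x.toReal)
      = ∑ v ∈ f.nonzeroValues, f.fibreSum p k v * clip (γ * v) := by
    classical
    rw [← Finset.sum_fiberwise_of_maps_to (s := Finset.univ) (t := f.nonzeroValues)
      (g := fun x : Cube n => f.eval x.toReal) fun x _ => hgp.eval_mem_nonzeroValues hε x]
    refine Finset.sum_congr rfl fun v _ => ?_
    rw [fibreSum, Finset.sum_mul]
    refine Finset.sum_congr (by congr) fun x hx => ?_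
    rw [(Finset.mem_filter.1 hx).2]
  rw [← e, Finset.mul_sum]
  have : ∀ x : Cube n, Cube.tilt p k x * clippedSigma (γ * f.eval x.toReal)
      = 1 / 2 * (Cube.tilt p k x * 1)
        + 1 / 2 * (Cube.tilt p k x * clip (γ * f.eval x.toReal)) := fun x => by
    rw [clippedSigma]
    ring
  rw [Finset.sum_congr rfl fun x _ => this x, Finset.sum_add_distrib, ← Finset.mul_sum, hz]
  simp

theorem two_mul_le_toReal_sub (h0 : δ < p k) (h1 : p k < 1 - δ) (x : Cube n) :
    (x k = 1 ∧ 2 * δ ≤ x.toReal k - (2 * p k - 1)) ∨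
      (x k = -1 ∧ x.toReal k - (2 * p k - 1) ≤ -(2 * δ)) := by
  rcases Int.units_eq_one_or (x k) with hx | hx
  · refine Or.inl ⟨hx, ?_⟩
    simp only [Cube.toReal, hx, Units.val_one, Int.cast_one]
    linarith
  · refine Or.inr ⟨hx, ?_⟩
    simp only [Cube.toReal, hx, Units.val_neg, Units.val_one, Int.cast_neg, Int.cast_one]
    linarith

theorem ComponentHasLinear.le_abs_fibreSum (hk : f.ComponentHasLinear k)
    (hgp : f.GeneralPosition ε) (hε : 0 < ε) (hδ : 0 < δ) (hδ1 : δ ≤ 1) (h0 : ∀ i, δ < p i)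
    (h1 : ∀ i, p i < 1 - δ) (x₀ : Cube n) :
    2 * δ ^ (f.numRelevant + 2) ≤ |f.fibreSum p k (f.eval x₀.toReal)| := by
  classical
  obtain ⟨j, hj, hkj⟩ := hk
  have e : f.fibreSum p k (f.eval x₀.toReal)
      = (∑ x with f.eval x.toReal = f.eval x₀.toReal, Cube.weight p x)
        * (x₀.toReal k - (2 * p k - 1)) := by
    rw [fibreSum, Finset.sum_mul]
    refine Finset.sum_congr (by congr) fun x hx => ?_
    have hx' := (hgp.eval_eq_iff hε).1 (Finset.mem_filter.1 hx).2
    have := hx'.mul_eq_mul_of_reachable hkj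
    -- Both x_k x_j and x_j are constant on the fibre, hence so is x_k.
    rw [hx'.2 j hj, mul_left_inj] at this
    rw [Cube.tilt, Cube.toReal, this, Cube.toReal]
  have hw := pow_numRelevant_le_sum_weight (f := f) hδ h0 h1 x₀
  have hk2 : 2 * δ ≤ |x₀.toReal k - (2 * p k - 1)| := by
    rcases two_mul_le_toReal_sub (h0 k) (h1 k) x₀ with ⟨-, h⟩ | ⟨-, h⟩
    · exact h.trans (le_abs_self _)
    · exact (le_neg.1 h).trans (neg_le_abs _)
  have hr : 0 < δ ^ f.numRelevant := pow_pos hδ _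
  rw [e, abs_mul, abs_of_pos (hr.trans_le hw)]
  calc 2 * δ ^ (f.numRelevant + 2) = δ ^ f.numRelevant * (2 * δ * δ) := by ring
    _ ≤ δ ^ f.numRelevant * (2 * δ) := by
        gcongr
        exact mul_le_of_le_one_right (by linarith) hδ1
    _ ≤ _ := mul_le_mul hw hk2 (by linarith) (hr.le.trans hw)

/-! ### Components without a linear term -/

open Classical in
/-- The variables in the connected component of `k`. -/
noncomputable def component (f : QuadPoly n) (k : Fin n) : Finset (Fin n) :=
  Finset.univ.filter fun i => f.graph.Reachable k i

theorem mem_component {i : Fin n} : i ∈ f.component k ↔ f.graph.Reachable k i := by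
  simp [component]

theorem self_mem_component : k ∈ f.component k := mem_component.2 (SimpleGraph.Reachable.refl k)

/-- The log-odds of the coordinates of `x` at the other variables in the component of `k`. -/
noncomputable def componentLogOdds (f : QuadPoly n) (p : Fin n → ℝ) (k : Fin n) (x : Cube n) : ℝ :=
  ∑ i ∈ (f.component k).erase k, x.toReal i * Cube.logOdds (p i)

theorem eval_flip_component (hk : ¬ f.ComponentHasLinear k) (x : Cube n) :
    f.eval (Cube.flip (f.component k) x).toReal = f.eval x.toReal := by
  refine SameTerms.eval_eq ⟨fun q hq => ?_, fun j hj => ?_⟩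
  · have hiff : q.1 ∈ f.component k ↔ q.2 ∈ f.component k := by
      by_cases hne : q.1 = q.2
      · rw [hne]
      · have hadj : f.graph.Adj q.1 q.2 := graph_adj_iff.2 ⟨hne, Or.inl hq⟩
        rw [mem_component, mem_component]
        exact ⟨fun h => h.trans hadj.reachable, fun h => h.trans hadj.symm.reachable⟩
    by_cases h : q.1 ∈ f.component k
    · rw [Cube.flip_apply_mem h, Cube.flip_apply_mem (hiff.1 h), neg_mul_neg]
    · rw [Cube.flip_apply_notMem h, Cube.flip_apply_notMem fun h' => h (hiff.2 h')]
  · exact Cube.flip_apply_notMem (fun h => hk ⟨j, hj, mem_component.1 h⟩) x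

theorem DependsOnVar.exists_adj (hd : f.DependsOnVar k) (hk : ¬ f.ComponentHasLinear k) :
    ∃ i, f.graph.Adj k i := by
  obtain ⟨x, y, hxy, hne⟩ := hd
  have hn : ¬ f.SameTerms x y := fun hn => hne hn.eval_eq
  rw [SameTerms, not_and_or] at hn
  push Not at hn
  rcases hn with ⟨q, hq, h⟩ | ⟨j, hj, h⟩
  · have hne' : q.1 ≠ q.2 := fun he => h (by rw [he, Int.units_mul_self, Int.units_mul_self])
    by_cases h1 : q.1 = k
    · exact ⟨q.2, h1 ▸ graph_adj_iff.2 ⟨hne', Or.inl hq⟩⟩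
    · by_cases h2 : q.2 = k
      · exact ⟨q.1, h2 ▸ graph_adj_iff.2 ⟨hne'.symm, Or.inr hq⟩⟩
      · exact absurd (by rw [hxy _ h1, hxy _ h2]) h
  · refine absurd ⟨j, hj, ?_⟩ hk
    by_cases hjk : j = k
    · rw [hjk]
    · exact absurd (hxy j hjk) h

theorem SameTerms.toReal_mul_componentLogOdds {x y : Cube n} (h : f.SameTerms x y) :
    x.toReal k * f.componentLogOdds p k x = y.toReal k * f.componentLogOdds p k y := by
  rw [componentLogOdds, componentLogOdds, Finset.mul_sum, Finset.mul_sum]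
  refine Finset.sum_congr rfl fun i hi => ?_
  have := h.mul_eq_mul_of_reachable (mem_component.1 (Finset.mem_of_mem_erase hi))
  have e : x.toReal k * x.toReal i = y.toReal k * y.toReal i := by
    simp only [Cube.toReal]
    exact_mod_cast congrArg Units.val this
  rw [← mul_assoc, e, mul_assoc]

theorem two_mul_le_one_sub_exp {E : ℝ} (hδ : 0 < δ) (hδ2 : δ < 1 / 2)
    (hE : Real.log ((1 + 2 * δ) / (1 - 2 * δ)) ≤ E) : 2 * δ ≤ 1 - Real.exp (-E) := by
  have hp : 0 < (1 + 2 * δ) / (1 - 2 * δ) := div_pos (by linarith) (by linarith)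
  have h := Real.exp_le_exp.2 (neg_le_neg hE)
  rw [Real.exp_neg (Real.log _), Real.exp_log hp, inv_div] at h
  have : (1 - 2 * δ) / (1 + 2 * δ) ≤ 1 - 2 * δ := div_le_self (by linarith) (by linarith)
  linarith

theorem two_mul_le_exp_sub_one {E : ℝ} (hδ : 0 < δ) (hδ2 : δ < 1 / 2)
    (hE : Real.log ((1 + 2 * δ) / (1 - 2 * δ)) ≤ E) : 2 * δ ≤ Real.exp E - 1 := by
  have hp : 0 < (1 + 2 * δ) / (1 - 2 * δ) := div_pos (by linarith) (by linarith)
  have h := Real.exp_le_exp.2 hE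
  rw [Real.exp_log hp] at h
  have : 1 + 2 * δ ≤ (1 + 2 * δ) / (1 - 2 * δ) :=
    le_div_self (by linarith) (by linarith) (by linarith)
  linarith

theorem log_le_abs_logOdds {t : ℝ} (hδ : 0 < δ)
    (ht : t ∈ Set.Ioo δ (1 / 2 - δ) ∪ Set.Ioo (1 / 2 + δ) (1 - δ)) :
    Real.log ((1 + 2 * δ) / (1 - 2 * δ)) ≤ |Cube.logOdds t| := by
  rcases ht with ⟨a, c⟩ | ⟨a, c⟩
  · have hp : 0 < (1 + 2 * δ) / (1 - 2 * δ) := div_pos (by linarith) (by linarith)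
    refine le_trans ?_ (neg_le_abs _)
    rw [Cube.logOdds, ← Real.log_inv, inv_div]
    refine Real.log_le_log hp ?_
    rw [div_le_div_iff₀ (by linarith) (by linarith)]
    nlinarith
  · have hp : 0 < (1 + 2 * δ) / (1 - 2 * δ) := div_pos (by linarith) (by linarith)
    refine le_trans ?_ (le_abs_self _)
    refine Real.log_le_log hp ?_
    rw [div_le_div_iff₀ (by linarith) (by linarith)]
    nlinarith

/-- The component flip permutes each fibre, so averaging over it pairs x with its flip. -/
theorem two_mul_fibreSum (hk : ¬ f.ComponentHasLinear k) (h0 : ∀ i, 0 < p i)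
    (h1 : ∀ i, p i < 1) (v : ℝ) [DecidablePred fun x : Cube n => f.eval x.toReal = v] :
    2 * f.fibreSum p k v = ∑ x with f.eval x.toReal = v,
      Cube.weight p x * ((x.toReal k - (2 * p k - 1))
        * (1 - Real.exp (-f.componentLogOdds p k x))) := by
  have e : f.fibreSum p k v = ∑ x with f.eval x.toReal = v, Cube.tilt p k x := by
    rw [fibreSum]
    congr
  have e' : f.fibreSum p k v
      = ∑ x with f.eval x.toReal = v, Cube.tilt p k (Cube.flip (f.component k) x) := by
    rw [e, Finset.sum_filter, Finset.sum_filter,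
      ← Equiv.sum_comp (Cube.flipEquiv (f.component k))]
    refine Finset.sum_congr rfl fun x _ => ?_
    change (if f.eval (Cube.flip (f.component k) x).toReal = v then
      Cube.tilt p k (Cube.flip (f.component k) x) else 0) = _
    simp only [eval_flip_component hk]
  rw [two_mul]
  nth_rewrite 1 [e]
  rw [e', ← Finset.sum_add_distrib]
  refine Finset.sum_congr rfl fun x _ => ?_
  rw [Cube.tilt_flip h0 h1 self_mem_component, Cube.tilt, componentLogOdds]
  ring

theorem GeneralPosition.le_abs_fibreSum (hgp : f.GeneralPosition ε) (hε : 0 < ε)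
    (hk : ¬ f.ComponentHasLinear k) (hδ : 0 < δ) (hδ2 : δ < 1 / 2) (h0 : ∀ i, δ < p i)
    (h1 : ∀ i, p i < 1 - δ) (x₀ : Cube n)
    (hE : Real.log ((1 + 2 * δ) / (1 - 2 * δ)) ≤ |f.componentLogOdds p k x₀|) :
    2 * δ ^ (f.numRelevant + 2) ≤ |f.fibreSum p k (f.eval x₀.toReal)| := by
  classical
  have key := two_mul_fibreSum hk (fun i => hδ.trans (h0 i)) (fun i => by linarith [h1 i])
    (f.eval x₀.toReal)
  have hw := pow_numRelevant_le_sum_weight (f := f) hδ h0 h1 x₀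
  have hwpos : ∀ x, 0 < Cube.weight p x :=
    Cube.weight_pos (fun i => hδ.trans (h0 i)) (fun i => by linarith [h1 i])
  have hsame : ∀ x : Cube n, f.eval x.toReal = f.eval x₀.toReal →
      x.toReal k * f.componentLogOdds p k x = x₀.toReal k * f.componentLogOdds p k x₀ :=
    fun x hx => ((hgp.eval_eq_iff hε).1 hx).toReal_mul_componentLogOdds
  have habs : |x₀.toReal k * f.componentLogOdds p k x₀| = |f.componentLogOdds p k x₀| := by
    rw [abs_mul, Cube.toReal, abs_unit_cast, one_mul]
  rw [← habs] at hE
  have hmain : 4 * δ ^ (f.numRelevant + 2) ≤ |2 * f.fibreSum p k (f.eval x₀.toReal)| := by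
    have hbase : 4 * δ ^ (f.numRelevant + 2)
        ≤ ∑ x with f.eval x.toReal = f.eval x₀.toReal, Cube.weight p x * (2 * δ * (2 * δ)) := by
      rw [← Finset.sum_mul]
      calc 4 * δ ^ (f.numRelevant + 2) = δ ^ f.numRelevant * (2 * δ * (2 * δ)) := by ring
        _ ≤ _ := by gcongr
    rw [key]
    -- The sign of x_k E(x), constant on the fibre, is the sign of every summand; both factors are
    -- at least 2δ in modulus.
    rcases le_abs'.1 hE with hE' | hE'
    · refine le_trans ?_ (neg_le_abs _)
      rw [← Finset.sum_neg_distrib]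
      refine hbase.trans (Finset.sum_le_sum fun x hx => ?_)
      rw [← mul_neg]
      refine mul_le_mul_of_nonneg_left ?_ (hwpos x).le
      have hx' := hsame x (Finset.mem_filter.1 hx).2
      rw [← hx'] at hE'
      rcases two_mul_le_toReal_sub (h0 k) (h1 k) x with ⟨hxk, h⟩ | ⟨hxk, h⟩
      · have : f.componentLogOdds p k x ≤ -Real.log ((1 + 2 * δ) / (1 - 2 * δ)) := by
          simpa [Cube.toReal, hxk] using hE'
        have := two_mul_le_exp_sub_one hδ hδ2 (le_neg.1 this)
        nlinarith
      · have : Real.log ((1 + 2 * δ) / (1 - 2 * δ)) ≤ f.componentLogOdds p k x := by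
          simpa [Cube.toReal, hxk] using hE'
        have := two_mul_le_one_sub_exp hδ hδ2 this
        nlinarith
    · refine le_trans ?_ (le_abs_self _)
      refine hbase.trans (Finset.sum_le_sum fun x hx => ?_)
      refine mul_le_mul_of_nonneg_left ?_ (hwpos x).le
      have hx' := hsame x (Finset.mem_filter.1 hx).2
      rw [← hx'] at hE'
      rcases two_mul_le_toReal_sub (h0 k) (h1 k) x with ⟨hxk, h⟩ | ⟨hxk, h⟩
      · have : Real.log ((1 + 2 * δ) / (1 - 2 * δ)) ≤ f.componentLogOdds p k x := by
          simpa [Cube.toReal, hxk] using hE'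
        have := two_mul_le_one_sub_exp hδ hδ2 this
        nlinarith
      · have : Real.log ((1 + 2 * δ) / (1 - 2 * δ)) ≤ -f.componentLogOdds p k x := by
          simpa [Cube.toReal, hxk] using hE'
        have := two_mul_le_exp_sub_one hδ hδ2 this
        nlinarith
  rw [abs_mul, abs_two] at hmain
  linarith

theorem componentLogOdds_flip {i : Fin n} (hi : f.graph.Adj k i) (x : Cube n) :
    f.componentLogOdds p k (Cube.flip {i} x)
      = f.componentLogOdds p k x - 2 * (x.toReal i * Cube.logOdds (p i)) := by
  have hm : i ∈ (f.component k).erase k :=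
    Finset.mem_erase.2 ⟨hi.ne', mem_component.2 hi.reachable⟩
  rw [componentLogOdds, componentLogOdds, ← Finset.add_sum_erase _ _ hm,
    ← Finset.add_sum_erase _ _ hm]
  have h1 : (Cube.flip {i} x).toReal i = -x.toReal i := by
    simp [Cube.toReal, Cube.flip_apply_mem]
  have h2 : ∀ j ∈ ((f.component k).erase k).erase i, (Cube.flip {i} x).toReal j = x.toReal j := by
    intro j hj
    rw [Cube.toReal, Cube.toReal, Cube.flip_apply_notMem]
    simpa using Finset.ne_of_mem_erase hj
  rw [h1, Finset.sum_congr rfl fun j hj => by rw [h2 j hj]]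
  ring

theorem le_abs_componentLogOdds_or {i : Fin n} (hi : f.graph.Adj k i) (x : Cube n) {l : ℝ}
    (hl : l ≤ |Cube.logOdds (p i)|) :
    l ≤ |f.componentLogOdds p k x| ∨ l ≤ |f.componentLogOdds p k (Cube.flip {i} x)| := by
  by_contra! hc
  have h := abs_sub (f.componentLogOdds p k x) (f.componentLogOdds p k (Cube.flip {i} x))
  rw [componentLogOdds_flip hi, sub_sub_cancel, abs_mul, abs_mul, abs_two, Cube.toReal,
    abs_unit_cast, ← Cube.toReal, ← componentLogOdds_flip hi] at h
  linarith [hc.1, hc.2]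

/-- A flip changes each monomial by a sign independent of the point, so it induces an injective map
on values; this map sends bad values to good ones. -/
theorem GeneralPosition.card_nonzeroValues_le (hgp : f.GeneralPosition ε) (hε : 0 < ε)
    (C : Finset (Fin n)) (Good : ℝ → Prop) [DecidablePred Good]
    (h : ∀ x : Cube n, Good (f.eval x.toReal) ∨ Good (f.eval (Cube.flip C x).toReal)) :
    f.nonzeroValues.card ≤ 2 * (f.nonzeroValues.filter Good).card := by
  have hex : ∀ v ∈ f.nonzeroValues, ∃ x : Cube n, f.eval x.toReal = v :=
    fun v hv => (mem_nonzeroValues.1 hv).1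
  choose! pt hpt using hex
  have hle : (f.nonzeroValues.filter fun v => ¬ Good v).card
      ≤ (f.nonzeroValues.filter Good).card := by
    refine Finset.card_le_card_of_injOn (fun v => f.eval (Cube.flip C (pt v)).toReal)
      (fun v hv => ?_) fun v hv w hw hvw => ?_
    · obtain ⟨hvV, hbad⟩ := Finset.mem_filter.1 hv
      refine Finset.mem_coe.2 (Finset.mem_filter.2 ⟨hgp.eval_mem_nonzeroValues hε _, ?_⟩)
      refine (h (pt v)).resolve_left ?_
      rwa [hpt v hvV]
    · have := ((hgp.eval_eq_iff hε).1 hvw).flip C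
      rw [Cube.flip_flip, Cube.flip_flip] at this
      rw [← hpt v (Finset.mem_filter.1 hv).1, ← hpt w (Finset.mem_filter.1 hw).1]
      exact this.eval_eq
  have := Finset.card_filter_add_card_filter_not (s := f.nonzeroValues) Good
  omega

theorem GeneralPosition.exists_large_sum_fibreSum_mul_clip (hgp : f.GeneralPosition ε)
    (hε : 0 < ε) {b : ℝ} (hb : f.CoeffBound b) {s : ℕ} (hs : f.Sparse s) (hd : f.DependsOnVar k)
    (hδ : 0 < δ) {vm : ℝ} (hvm : vm ∈ f.nonzeroValues)
    (hmin : ∀ v ∈ f.nonzeroValues, |vm| ≤ |v|) {S : Finset ℝ} (hS : S ⊆ f.nonzeroValues)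
    (hlarge : ∀ v ∈ S, 2 * δ ^ (f.numRelevant + 2) ≤ |f.fibreSum p k v|) :
    0 < b ^ 2 * (s : ℝ) ^ 2 ∧
    ∃ A : Set ℝ, MeasurableSet A ∧ A ⊆ Set.Ioo 0 (1 / |vm|) ∧
      ENNReal.ofReal (S.card * (7 / 8 * (ε / (b ^ 2 * (s : ℝ) ^ 2)))) ≤ volume A ∧
      ∀ γ ∈ A, 1 / 16 * (ε ^ 2 * δ ^ (f.numRelevant + 2) / (b ^ 2 * (s : ℝ) ^ 2))
        < |∑ v ∈ f.nonzeroValues, f.fibreSum p k v * clip (γ * v)| := by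
  set B := b ^ 2 * (s : ℝ) ^ 2
  have hV : ∀ v ∈ f.nonzeroValues, ε < |v| := fun v hv => by
    obtain ⟨⟨x, rfl⟩, -⟩ := mem_nonzeroValues.1 hv
    exact hgp.lt_abs x
  have hprod : ∀ v ∈ f.nonzeroValues, ∀ w ∈ f.nonzeroValues, v ≠ w → |v| * |w| ≤ B :=
    fun v hv w hw hne => by
      obtain ⟨⟨x, rfl⟩, -⟩ := mem_nonzeroValues.1 hv
      obtain ⟨⟨y, rfl⟩, -⟩ := mem_nonzeroValues.1 hw
      exact hb.abs_mul_abs_le hs hne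
  -- A second value w gives ε|v| ≤ |w||v| ≤ B, whence B > 0 and h ≤ 1/|v|.
  have hother : ∀ v ∈ f.nonzeroValues, ∃ w ∈ f.nonzeroValues, v ≠ w := fun v hv => by
    obtain ⟨x, y, -, hne⟩ := hd
    by_cases hx : v = f.eval x.toReal
    · exact ⟨_, hgp.eval_mem_nonzeroValues hε y, hx ▸ hne⟩
    · exact ⟨_, hgp.eval_mem_nonzeroValues hε x, hx⟩
  have hB : 0 < B := by
    obtain ⟨w, hw, hne⟩ := hother vm hvm
    exact (mul_pos (hε.trans (hV vm hvm)) (hε.trans (hV w hw))).trans_le (hprod vm hvm w hw hne)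
  have hpow : 0 < δ ^ (f.numRelevant + 2) := pow_pos hδ _
  refine ⟨hB, ?_⟩
  -- κ is the product of the lower bounds for |a_v| and |v|. With this t, 4t/κ = h/8, so each value
  -- in `S` contributes 7h/8.
  obtain ⟨A, hA, hsub, hvol, hlt⟩ := exists_large_sum_clip (S := S) (a := f.fibreSum p k)
    (h := ε / B) (t := 1 / 16 * (ε ^ 2 * δ ^ (f.numRelevant + 2) / B))
    (κ := 2 * δ ^ (f.numRelevant + 2) * ε)
    (fun v hv => abs_pos.1 (hε.trans (hV v hv))) hmin hvm (by positivity)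
    (fun v hv => by
      obtain ⟨w, hw, hne⟩ := hother v hv
      rw [div_le_div_iff₀ hB (hε.trans (hV v hv)), one_mul, mul_comm]
      exact (mul_le_mul_of_nonneg_left (hV w hw).le (abs_nonneg v)).trans (hprod v hv w hw hne))
    (by positivity) (by positivity)
    (fun v hv w hw hne => by
      have hv0 := hε.trans (hV v hv)
      have hw0 := hε.trans (hV w hw)
      have hP := hprod v hv w hw hne
      have hsep : 2 * ε ≤ |(|w| - |v|)| := by
        obtain ⟨⟨x, rfl⟩, -⟩ := mem_nonzeroValues.1 hv
        obtain ⟨⟨y, rfl⟩, -⟩ := mem_nonzeroValues.1 hw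
        exact hgp.abs_sub_abs hne.symm
      rw [div_sub_div _ _ hv0.ne' hw0.ne', one_mul, mul_one, abs_div,
        abs_of_pos (mul_pos hv0 hw0), ← mul_div_assoc]
      exact div_le_div₀ (abs_nonneg _) hsep (mul_pos hv0 hw0) hP)
    hS (fun v hv => by
      rw [abs_mul]
      exact mul_le_mul (hlarge v hv) (hV v (hS hv)).le hε.le (abs_nonneg _))
  refine ⟨A, hA, hsub, ?_, hlt⟩
  convert hvol using 3
  field_simp
  norm_num

end QuadPoly

/-! ### The main theorem -/

theorem deltaDoublePrime_le {δ : ℝ} (hδ : 0 < δ) (hδ1 : δ ≤ 1) (r : ℕ) :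
    deltaDoublePrime δ r ≤ δ ^ r := by
  have h1 : min ((2 : ℝ) ^ (deltaPrime δ / 2) - 1) (1 - (2 : ℝ) ^ (-(deltaPrime δ / 2))) ≤ 1 :=
    (min_le_right _ _).trans (sub_le_self _ (by positivity))
  calc deltaDoublePrime δ r ≤ δ ^ (2 * r) * 1 :=
        mul_le_mul_of_nonneg_left h1 (pow_pos hδ _).le
    _ ≤ δ ^ r := by
        rw [mul_one]
        exact pow_le_pow_of_le_one hδ.le hδ1 (by omega)

theorem theorem2 {n : ℕ} (f : QuadPoly n) (s : ℕ) (b ε δ : ℝ) (hε : 0 < ε) (hδ : 0 < δ)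
    (hsparse : f.Sparse s) (hb : f.CoeffBound b) (hgp : f.GeneralPosition ε)
    (p : Fin n → ℝ)
    (hp : ∀ i, p i ∈ Set.Ioo δ (1 / 2 - δ) ∪ Set.Ioo (1 / 2 + δ) (1 - δ))
    {Ω : ℝ → Type*} [∀ γ, MeasurableSpace (Ω γ)] (P : ∀ γ, Measure (Ω γ))
    [∀ γ, IsProbabilityMeasure (P γ)]
    (X : ∀ γ, Fin n → Ω γ → ℝ) (Y : ∀ γ, Ω γ → ℝ)
    (hmodel : ∀ γ, 0 < γ → QuadModel (P γ) clippedSigma f p γ (X γ) (Y γ))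
    (vm : ℝ) (hvm : vm ∈ f.nonzeroValues) (hvm_min : ∀ v ∈ f.nonzeroValues, |vm| ≤ |v|)
    (k : Fin n) :
    (¬ f.DependsOnVar k → ∀ γ, 0 < γ → |correlation (P γ) (Y γ) (X γ k)| = 0) ∧
    (f.DependsOnVar k →
      Set.Ioo 0 (1 / |vm|) ⊆ Set.Ioo 0 (1 / ε) ∧
      (f.ComponentHasLinear k →
        ∃ A : Set ℝ, MeasurableSet A ∧ A ⊆ Set.Ioo 0 (1 / |vm|) ∧
          ENNReal.ofReal (3 / 8 * ((f.nonzeroValues.card : ℝ) * ε / (b ^ 2 * (s : ℝ) ^ 2)))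
            ≤ volume A ∧
          ∀ γ ∈ A, 1 / 32 * (ε ^ 2 * δ ^ (f.numRelevant + 2) / (b ^ 2 * (s : ℝ) ^ 2))
            < |correlation (P γ) (Y γ) (X γ k)|) ∧
      (¬ f.ComponentHasLinear k →
        ∃ A : Set ℝ, MeasurableSet A ∧ A ⊆ Set.Ioo 0 (1 / |vm|) ∧
          ENNReal.ofReal (3 / 32 * ((f.nonzeroValues.card : ℝ) * ε / (b ^ 2 * (s : ℝ) ^ 2)))
            ≤ volume A ∧
          ∀ γ ∈ A,
            1 / 32 * (ε ^ 2 * δ ^ 2 * deltaDoublePrime δ f.numRelevant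
                / (b ^ 2 * (s : ℝ) ^ 2))
              < |correlation (P γ) (Y γ) (X γ k)|)) := by
  have h0 : ∀ i, δ < p i := fun i => by rcases hp i with h | h <;> linarith [h.1]
  have h1 : ∀ i, p i < 1 - δ := fun i => by rcases hp i with h | h <;> linarith [h.1, h.2]
  have hp0 : ∀ i, 0 < p i := fun i => hδ.trans (h0 i)
  have hp1 : ∀ i, p i < 1 := fun i => by linarith [h1 i]
  have hδ2 : δ < 1 / 2 := by rcases hp k with h | h <;> linarith [h.1, h.2]
  have hδ1 : δ ≤ 1 := by linarith
  have hvmε : ε < |vm| := by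
    obtain ⟨⟨x, rfl⟩, -⟩ := QuadPoly.mem_nonzeroValues.1 hvm
    exact hgp.lt_abs x
  have hcorr : ∀ γ, 0 < γ → |correlation (P γ) (Y γ) (X γ k)|
      = 1 / 2 * |∑ v ∈ f.nonzeroValues, f.fibreSum p k v * clip (γ * v)| := fun γ hγ => by
    rw [(hmodel γ hγ).correlation_eq hp0 hp1, hgp.sum_tilt_mul_clippedSigma hε hp0 hp1, abs_mul,
      abs_of_pos (one_half_pos (α := ℝ))]
  refine ⟨fun hk γ hγ => ?_, fun hd => ⟨?_, fun hk => ?_, fun hk => ?_⟩⟩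
  · rw [abs_eq_zero, (hmodel γ hγ).correlation_eq hp0 hp1]
    exact Cube.sum_tilt_mul_eq_zero hp0 hp1 k _ fun x => by
      rw [QuadPoly.eval_flip_of_not_dependsOnVar hk]
  · exact Set.Ioo_subset_Ioo_right (one_div_le_one_div_of_le hε hvmε.le)
  · obtain ⟨hB, A, hA, hsub, hvol, hlt⟩ := hgp.exists_large_sum_fibreSum_mul_clip hε hb hsparse hd
      hδ hvm hvm_min (S := f.nonzeroValues) (p := p) (Finset.Subset.refl _) fun v hv => by
        obtain ⟨⟨x, rfl⟩, -⟩ := QuadPoly.mem_nonzeroValues.1 hv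
        exact hk.le_abs_fibreSum hgp hε hδ hδ1 h0 h1 x
    refine ⟨A, hA, hsub, (ENNReal.ofReal_le_ofReal ?_).trans hvol, fun γ hγ => ?_⟩
    · have : 0 ≤ (f.nonzeroValues.card : ℝ) * (ε / (b ^ 2 * (s : ℝ) ^ 2)) := by positivity
      rw [mul_div_assoc]
      linarith
    · rw [hcorr γ (hsub hγ).1]
      linarith [hlt γ hγ]
  · classical
    obtain ⟨i, hi⟩ := hd.exists_adj hk
    have hcard := hgp.card_nonzeroValues_le hε {i}
      (fun v => 2 * δ ^ (f.numRelevant + 2) ≤ |f.fibreSum p k v|) fun x =>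
        (QuadPoly.le_abs_componentLogOdds_or hi x (QuadPoly.log_le_abs_logOdds hδ (hp i))).imp
          (hgp.le_abs_fibreSum hε hk hδ hδ2 h0 h1 _) (hgp.le_abs_fibreSum hε hk hδ hδ2 h0 h1 _)
    obtain ⟨hB, A, hA, hsub, hvol, hlt⟩ := hgp.exists_large_sum_fibreSum_mul_clip hε hb hsparse hd
      hδ hvm hvm_min (p := p) (Finset.filter_subset _ _) fun v hv => (Finset.mem_filter.1 hv).2
    refine ⟨A, hA, hsub, (ENNReal.ofReal_le_ofReal ?_).trans hvol, fun γ hγ => ?_⟩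
    -- At least m/2 good values with 7h/8 each give 7mh/16, more than the 3mh/32 required.
    · have hcard' := (Nat.cast_le (α := ℝ)).2 hcard
      push_cast at hcard'
      have hh : 0 ≤ ε / (b ^ 2 * (s : ℝ) ^ 2) := by positivity
      have := mul_le_mul_of_nonneg_right hcard' hh
      have := mul_nonneg (Nat.cast_nonneg (α := ℝ) f.nonzeroValues.card) hh
      rw [mul_div_assoc]
      linarith
    · rw [hcorr γ (hsub hγ).1]
      -- The bound with δ^(r+2) holds in this case too, and it is the stronger one as δ'' ≤ δ^r.
      have hle : ε ^ 2 * δ ^ 2 * deltaDoublePrime δ f.numRelevant / (b ^ 2 * (s : ℝ) ^ 2)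
          ≤ ε ^ 2 * δ ^ (f.numRelevant + 2) / (b ^ 2 * (s : ℝ) ^ 2) := by
        rw [pow_add, mul_comm (δ ^ f.numRelevant), ← mul_assoc]
        gcongr
        exact deltaDoublePrime_le hδ hδ1 _
      linarith [hlt γ hγ]
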